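/- Let $K=\mathbb R$ or $\mathbb C$. For $v,w\in K^2$ write $[v,w]=v_1w_2-v_2w_1$, and let the cross-ratio of points $z_1,\dots,z_4$ of $\mathbb P^1(K)$ be $$[z_1,z_2,z_3,z_4]=\frac{(z_1-z_3)(z_2-z_4)}{(z_1-z_4)(z_2-z_3)}=\frac{[v_1,v_3]\,[v_2,v_4]}{[v_1,v_4]\,[v_2,v_3]},$$ where $v_a\in K^2\setminus\{0\}$ are homogeneous coordinates of $z_a$. An ideal $n$-gon is a cyclically indexed family $(p_i)_{i\in\mathbb Z/n}$ of points of $\mathbb P^1(K)$. For $2\le k\le n-2$, an $(n,k)$-loxogon is an ideal $n$-gon with $p_i\neq p_{i+1}$ and $p_i\ne p_{i+2}$ for all $i$, such that the cross-ratios $[p_i,p_{i+1},p_{i+k},p_{i+k+1}]$ are well defined ($p_i\ne p_{i+k+1}$, $p_{i+1}\neq p_{i+k}$) and equal to one constant for all $i$. An ideal $n$-gon is (projectively) regular if, up to a projective transformation, $p_j=[\cos(\pi mj/n):\sin(\pi mj/n)]$ for all $j$, for some $m$ coprime to $n$ (the case $m=1$ is the convex regular $n$-gon, other $m$ give star-shaped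 ones). **Theorem.** Let $n$ be odd, $2\le k\le n-2$, and let $p$ be a regular ideal $n$-gon with homogeneous coordinates $P_i\in K^2\setminus\{0\}$, $i\in\mathbb Z/n$. Then $p$ has no non-trivial deformations in the class of $(n,k)$-loxogons: 1. (Infinitesimal deformations.) Let $V_i\in K^2$, $i\in\mathbb Z/n$. The derivatives at $t=0$ of the cross-ratios $[p_i(t),p_{i+1}(t),p_{i+k}(t),p_{i+k+1}(t)]$ of the polygon $p(t)$ with homogeneous coordinates $P_i+tV_i$ are the same for all $i$ if and only if the deformation is trivial, that is, there are $A\in\mathfrak{sl}(2,K)$ and $c_i\in K$ such that $V_i=AP_i+c_iP_i$ for all $i$. 2. (Deformations.) There is a neighbourhood of $(P_i)$ in $(K^2)^n$ such that every $(n,k)$-loxogon with homogeneous coordinates $(Q_i)$ in this neighbourhood is projectively equivalent to $p$. -/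

import Mathlib

open scoped LinearAlgebra.Projectivization Topology

namespace IdealPolygon

/-- The projective line over `K`. -/
abbrev ProjLine (K : Type*) [Field K] : Type _ := ℙ K (Fin 2 → K)

/-- The determinant of two vectors in the plane. -/
def bracket {K : Type*} [Field K] (u v : Fin 2 → K) : K := u 0 * v 1 - u 1 * v 0

/-- The cross-ratio `(z₁ - z₃)(z₂ - z₄) / ((z₁ - z₄)(z₂ - z₃))` in homogeneous coordinates
`z = v 0 / v 1`. -/
def vecCrossRatio {K : Type*} [Field K] (a b c d : Fin 2 → K) : K :=
  bracket a c * bracket b d / (bracket a d * bracket b c)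

/-- The cross-ratio of four points of the projective line. It is used for `p ≠ s` and `q ≠ r`
only. -/
noncomputable def crossRatio {K : Type*} [Field K] (p q r s : ProjLine K) : K :=
  vecCrossRatio p.rep q.rep r.rep s.rep

/-- The cross-ratio can be computed from arbitrary homogeneous coordinates. -/
theorem crossRatio_mk {K : Type*} [Field K] (a b c d : Fin 2 → K)
    (ha : a ≠ 0) (hb : b ≠ 0) (hc : c ≠ 0) (hd : d ≠ 0) :
    crossRatio (Projectivization.mk K a ha) (Projectivization.mk K b hb)
      (Projectivization.mk K c hc) (Projectivization.mk K d hd) = vecCrossRatio a b c d := by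
  obtain ⟨x, hx⟩ := Projectivization.exists_smul_eq_mk_rep K a ha
  obtain ⟨y, hy⟩ := Projectivization.exists_smul_eq_mk_rep K b hb
  obtain ⟨z, hz⟩ := Projectivization.exists_smul_eq_mk_rep K c hc
  obtain ⟨w, hw⟩ := Projectivization.exists_smul_eq_mk_rep K d hd
  have key : ∀ (s t : Kˣ) (u v : Fin 2 → K),
      bracket (s • u) (t • v) = (s : K) * t * bracket u v := by
    intro s t u v
    simp only [bracket, Pi.smul_apply, Units.smul_def, smul_eq_mul]
    ring
  unfold crossRatio vecCrossRatio
  rw [← hx, ← hy, ← hz, ← hw, key, key, key, key]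
  have h : ((x : K) * y * z * w) ≠ 0 :=
    mul_ne_zero (mul_ne_zero (mul_ne_zero x.ne_zero y.ne_zero) z.ne_zero) w.ne_zero
  calc _ = ((x : K) * y * z * w) * (bracket a c * bracket b d) /
        (((x : K) * y * z * w) * (bracket a d * bracket b c)) := by
        congr 1 <;> ring
    _ = _ := mul_div_mul_left _ _ h

/-- The `n`-gon in the projective line whose vertices have the homogeneous coordinates `P i`;
indices are cyclic. -/
def ofVectors {K : Type*} [Field K] {n : ℕ} (P : ZMod n → Fin 2 → K) (hP : ∀ i, P i ≠ 0) :
    ZMod n → ProjLine K :=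
  fun i => Projectivization.mk K (P i) (hP i)

/-- Two `n`-gons are projectively equivalent: some projective transformation takes the vertices
of the first one to those of the second one. -/
def ProjEquiv {K : Type*} [Field K] {n : ℕ} (p q : ZMod n → ProjLine K) : Prop :=
  ∃ g : LinearMap.GeneralLinearGroup K (Fin 2 → K), ∀ i, q i = g • p i

/-- Consecutive vertices are distinct and consecutive sides are distinct. -/
def Nondegenerate {K : Type*} [Field K] {n : ℕ} (p : ZMod n → ProjLine K) : Prop :=
  ∀ i, p i ≠ p (i + 1) ∧ p i ≠ p (i + 2)

/-- `(n, k)`-loxogons: nondegenerate `n`-gons for which the cross-ratios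
`[p i, p (i + 1), p (i + k), p (i + k + 1)]` are well defined (as elements of `K`) and do not
depend on `i`; here `2 ≤ k ≤ n - 2`. -/
def IsLoxogon {K : Type*} [Field K] {n : ℕ} (k : ℕ) (p : ZMod n → ProjLine K) : Prop :=
  2 ≤ k ∧ k + 2 ≤ n ∧ Nondegenerate p ∧
    ∃ α : K, ∀ i, p i ≠ p (i + k + 1) ∧ p (i + 1) ≠ p (i + k) ∧
      crossRatio (p i) (p (i + 1)) (p (i + k)) (p (i + k + 1)) = α

theorem cos_sin_ne_zero (K : Type*) [RCLike K] (x : ℝ) :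
    (![(Real.cos x : K), (Real.sin x : K)] : Fin 2 → K) ≠ 0 := by
  intro h
  have h0 : (Real.cos x : K) = 0 := congrFun h 0
  have h1 : (Real.sin x : K) = 0 := congrFun h 1
  have h0' : Real.cos x = 0 := by exact_mod_cast h0
  have h1' : Real.sin x = 0 := by exact_mod_cast h1
  have := Real.sin_sq_add_cos_sq x
  rw [h0', h1'] at this
  norm_num at this

/-- The point of the projective line given by the line through the origin that forms the angle `x`
with the first coordinate axis. -/
noncomputable def anglePoint (K : Type*) [RCLike K] (x : ℝ) : ProjLine K :=
  Projectivization.mk K ![(Real.cos x : K), (Real.sin x : K)] (cos_sin_ne_zero K x)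

/-- Projectively regular `n`-gons: up to a projective transformation, the `j`-th vertex is
`[cos (π m j / n) : sin (π m j / n)]`, where `m` is coprime to `n`. For `m = 1` this is the convex
regular `n`-gon inscribed in the circle `ℝℙ¹`, the other `m` give the star-shaped ones. -/
def IsProjRegular {K : Type*} [RCLike K] {n : ℕ} (p : ZMod n → ProjLine K) : Prop :=
  ∃ m : ℕ, m.Coprime n ∧ ∃ g : LinearMap.GeneralLinearGroup K (Fin 2 → K),
    ∀ j : ℕ, p (j : ZMod n) = g • anglePoint K (Real.pi * m * j / n)

/-- The vectors `V i` define an infinitesimal deformation, in the class of `(n, k)`-loxogons, of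
the polygon with homogeneous coordinates `P i`: modulo `t ^ 2`, the cross-ratios
`[p i, p (i + 1), p (i + k), p (i + k + 1)]` of the polygon with homogeneous coordinates
`P i + t • V i` remain independent of `i`, that is, they all have the same derivative. -/
def IsInfinitesimalLoxogonDeformation {K : Type*} [RCLike K] {n : ℕ} (k : ℕ)
    (P V : ZMod n → Fin 2 → K) : Prop :=
  ∃ C : K, ∀ i, HasDerivAt
    (fun t : K => vecCrossRatio (P i + t • V i) (P (i + 1) + t • V (i + 1))
      (P (i + k) + t • V (i + k)) (P (i + k + 1) + t • V (i + k + 1))) C 0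

/-- The infinitesimal deformation given by the vectors `V i` is trivial: it is induced by an
element of the Lie algebra `sl(2)`. Here `V i` matters only modulo multiples of `P i`, since these
do not move the point with homogeneous coordinates `P i`. -/
def IsTrivialInfinitesimalDeformation {K : Type*} [RCLike K] {n : ℕ}
    (P V : ZMod n → Fin 2 → K) : Prop :=
  ∃ A : Matrix (Fin 2) (Fin 2) K, A.trace = 0 ∧ ∀ i, ∃ c : K, V i = A.mulVec (P i) + c • P i

end IdealPolygon

/-! Over `ℂ` a regular polygon is projectively the polygon of the powers `ω ^ i` of a primitive
`n`-th root of unity. If the vertex `z_i = ω ^ i` moves with velocity `z_i * w_i`, constancy of the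
logarithmic derivatives of the cross-ratios is a circulant linear system in `w`, which the discrete
Fourier transform diagonalizes. At a frequency `s ≠ 0` the eigenvalue vanishes only if `tan (kθ) tan
(sθ) = tan θ tan (ksθ)`, where `ω = exp (2iθ)`. The frequencies `0, 1, -1` correspond to the
velocity fields `a z`, `b z ^ 2`, `c`, that is, to `sl(2)`; infinitesimal rigidity says that there
are no others.

The heart is `tan_equation`. The equation is an integral polynomial relation in `ω`, so it survives
the Galois conjugations `ω ↦ ω ^ 2` and `ω ↦ ω ^ 4`, available because `n` is odd. The two
conjugates give equal sums and equal sums of squares for two pairs of numbers, so the pairs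
coincide; this forces `s` or `k` into `{0, 1, -1}`, and `2 ≤ k ≤ n - 2` excludes `k`.

Local rigidity follows from infinitesimal rigidity: a projective map fixes the positions of vertices
`0, 1, 2`, and on the remaining slice the loxogon equations have injective derivative
(`regular_slice_isolated`), so the regular polygon is an isolated solution. -/

namespace IdealPolygon

/-! ### Algebraic preliminaries. -/

/-- An integral polynomial relation satisfied by a primitive root of unity is satisfied by its
conjugates. -/
theorem aeval_pow_eq_zero_of_coprime {n m : ℕ} {ω : ℂ} (hω : IsPrimitiveRoot ω n) (hn : 0 < n)
    (hm : m.Coprime n) (p : Polynomial ℤ) (hp : Polynomial.aeval ω p = 0) :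
    Polynomial.aeval (ω ^ m) p = 0 := by
  have h1 : minpoly ℤ ω ∣ p := minpoly.isIntegrallyClosed_dvd (hω.isIntegral hn) hp
  rw [hω.minpoly_eq_pow_coprime hm] at h1
  obtain ⟨q, rfl⟩ := h1
  simp

theorem eq_and_eq_or_eq_and_eq_of_add_eq_of_sq_add_sq_eq {F : Type*} [Field F] [CharZero F]
    {a b c d : F} (h1 : a + b = c + d) (h2 : a ^ 2 + b ^ 2 = c ^ 2 + d ^ 2) :
    (a = c ∧ b = d) ∨ (a = d ∧ b = c) := by
  have h : 2 * ((a - c) * (a - d)) = 0 := by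
    have hb : b = c + d - a := by linear_combination h1
    subst hb
    linear_combination h2
  rcases mul_eq_zero.1 ((mul_eq_zero.1 h).resolve_left two_ne_zero) with h | h
  · left
    have := sub_eq_zero.1 h
    exact ⟨this, by linear_combination h1 - this⟩
  · right
    have := sub_eq_zero.1 h
    exact ⟨this, by linear_combination h1 - this⟩

theorem eq_or_mul_eq_one_of_add_inv_eq {F : Type*} [Field F] {a b : F} (ha : a ≠ 0) (hb : b ≠ 0)
    (h : a + a⁻¹ = b + b⁻¹) : a = b ∨ a * b = 1 := by
  field_simp at h
  have : (a - b) * (a * b - 1) = 0 := by linear_combination h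
  rcases mul_eq_zero.1 this with h | h
  · exact Or.inl (sub_eq_zero.1 h)
  · exact Or.inr (sub_eq_zero.1 h)

theorem eq_zero_of_eq_neg_of_odd {n : ℕ} (hn : Odd n) {a : ZMod n} (ha : a = -a) : a = 0 := by
  have hu : IsUnit ((2 : ℕ) : ZMod n) :=
    (ZMod.isUnit_iff_coprime 2 n).2 (Nat.coprime_two_left.2 hn)
  refine hu.mul_left_cancel ?_
  push_cast
  linear_combination ha

/-! ### The trigonometric equation and the circulant system. -/

section RootOfUnity

variable {n : ℕ} [NeZero n] {ω : ℂ} (hω : IsPrimitiveRoot ω n)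

/-- The additive character of `ZMod n` that takes `j` to `ω ^ j`. -/
noncomputable abbrev rootChar : AddChar (ZMod n) ℂ := AddChar.zmodChar n hω.pow_eq_one

theorem rootChar_injective : Function.Injective (rootChar hω) := by
  intro a b h
  rw [AddChar.zmodChar_apply, AddChar.zmodChar_apply] at h
  exact ZMod.val_injective n (hω.pow_inj (ZMod.val_lt a) (ZMod.val_lt b) h)

theorem rootChar_ne_zero (a : ZMod n) : rootChar hω a ≠ 0 :=
  ((rootChar hω).val_isUnit a).ne_zero

/-- All four character values are powers of `ω`, so the relation is a polynomial identity in `ω` and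
can be conjugated. -/
theorem rootChar_relation_pow (k s : ZMod n) {m : ℕ} (hm : m.Coprime n)
    (h : (rootChar hω k * rootChar hω s + 1) * (rootChar hω (k * s) + rootChar hω 1) =
      (rootChar hω 1 * rootChar hω (k * s) + 1) * (rootChar hω k + rootChar hω s)) :
    ((rootChar hω k) ^ m * (rootChar hω s) ^ m + 1) *
        ((rootChar hω (k * s)) ^ m + (rootChar hω 1) ^ m) =
      ((rootChar hω 1) ^ m * (rootChar hω (k * s)) ^ m + 1) *
        ((rootChar hω k) ^ m + (rootChar hω s) ^ m) := by
  have key := aeval_pow_eq_zero_of_coprime hω (NeZero.pos n) hm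
    ((.X ^ k.val * .X ^ s.val + 1) * (.X ^ (k * s).val + .X ^ (1 : ZMod n).val) -
      (.X ^ (1 : ZMod n).val * .X ^ (k * s).val + 1) * (.X ^ k.val + .X ^ s.val))
    (by
      simp only [AddChar.zmodChar_apply] at h
      simp only [map_sub, map_mul, map_add, map_pow, Polynomial.aeval_X, map_one]
      rw [h, sub_self])
  simp only [map_sub, map_mul, map_add, map_pow, Polynomial.aeval_X, map_one] at key
  simp only [AddChar.zmodChar_apply, ← pow_mul, mul_comm _ m] at key ⊢
  exact sub_eq_zero.1 key

theorem eq_of_rootChar_sq_eq (hn : Odd n) {a b : ZMod n}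
    (h : rootChar hω a ^ 2 = rootChar hω b ^ 2) : a = b := by
  rw [← AddChar.map_nsmul_eq_pow, ← AddChar.map_nsmul_eq_pow] at h
  have h2 := rootChar_injective hω h
  have hu : IsUnit ((2 : ℕ) : ZMod n) :=
    (ZMod.isUnit_iff_coprime 2 n).2 (Nat.coprime_two_left.2 hn)
  simp only [nsmul_eq_mul] at h2
  exact hu.mul_left_cancel h2

/-- For odd `n`, the equation `tan (k θ) * tan (s θ) = tan θ * tan (k s θ)`, where
`exp (2 i θ) = ω`, has only the obvious solutions. -/
theorem tan_equation (hn : Odd n) (k s : ZMod n)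
    (h : (rootChar hω k * rootChar hω s + 1) * (rootChar hω (k * s) + rootChar hω 1) =
      (rootChar hω 1 * rootChar hω (k * s) + 1) * (rootChar hω k + rootChar hω s)) :
    (s = 0 ∨ s = 1 ∨ s = -1) ∨ (k = 0 ∨ k = 1 ∨ k = -1) := by
  -- Exponents 2 and 4, rather than 1 and 2, keep the products `A, B, C, D` below free of square
  -- roots.
  have h2 := rootChar_relation_pow hω k s (Nat.coprime_two_left.2 hn) h
  have h4 := rootChar_relation_pow hω k s (m := 4)
    (by simpa using Nat.Coprime.pow_left 2 (Nat.coprime_two_left.2 hn)) h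
  have sq_eq : ∀ {a b : ZMod n}, rootChar hω a ^ 2 = rootChar hω b ^ 2 → a = b :=
    eq_of_rootChar_sq_eq hω hn
  have sq_mul : ∀ {a b : ZMod n}, rootChar hω a ^ 2 * rootChar hω b ^ 2 = 1 → a = -b := by
    intro a b hab
    apply sq_eq
    rw [AddChar.map_neg_eq_inv, inv_pow]
    exact eq_inv_of_mul_eq_one_left hab
  have hx := rootChar_ne_zero hω 1
  have hy := rootChar_ne_zero hω k
  have hu := rootChar_ne_zero hω s
  have hv := rootChar_ne_zero hω (k * s)
  set x := rootChar hω 1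
  set y := rootChar hω k
  set u := rootChar hω s
  set v := rootChar hω (k * s)
  have hA : y * u * v / x ≠ 0 := by positivity
  have hB : x * y * u / v ≠ 0 := by positivity
  have hC : x * v * y / u ≠ 0 := by positivity
  have hD : x * v * u / y ≠ 0 := by positivity
  -- This is `h2` divided by `x * y * u * v`. The same division of `h4` by the squares gives `e2`,
  -- after adding 4 to both sides to complete the squares.
  have e1 : (y * u * v / x + (y * u * v / x)⁻¹) + (x * y * u / v + (x * y * u / v)⁻¹) =
      (x * v * y / u + (x * v * y / u)⁻¹) + (x * v * u / y + (x * v * u / y)⁻¹) := by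
    field_simp
    linear_combination h2
  have e2 : (y * u * v / x + (y * u * v / x)⁻¹) ^ 2 + (x * y * u / v + (x * y * u / v)⁻¹) ^ 2 =
      (x * v * y / u + (x * v * y / u)⁻¹) ^ 2 + (x * v * u / y + (x * v * u / y)⁻¹) ^ 2 := by
    field_simp
    linear_combination h4
  -- Each matching reads `A = C` or `A * C = 1`, and so on, which is a relation between squares of
  -- two characters; squaring is injective as `n` is odd.
  rcases eq_and_eq_or_eq_and_eq_of_add_eq_of_sq_add_sq_eq e1 e2 with ⟨f1, f2⟩ | ⟨f1, f2⟩
  · rcases eq_or_mul_eq_one_of_add_inv_eq hA hC f1 with g1 | g1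
    · left; right; left
      apply sq_eq
      change u ^ 2 = x ^ 2
      field_simp at g1
      linear_combination g1
    rcases eq_or_mul_eq_one_of_add_inv_eq hB hD f2 with g2 | g2
    · right; left
      have q1 : k = -(k * s) := by
        apply sq_mul
        change y ^ 2 * v ^ 2 = 1
        field_simp at g1
        linear_combination g1
      have q2 : k = k * s := by
        apply sq_eq
        change y ^ 2 = v ^ 2
        field_simp at g2
        linear_combination g2
      rw [← q2] at q1
      exact eq_zero_of_eq_neg_of_odd hn q1
    · left; right; right
      apply sq_mul
      change u ^ 2 * x ^ 2 = 1
      field_simp at g2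
      linear_combination g2
  · rcases eq_or_mul_eq_one_of_add_inv_eq hA hD f1 with g1 | g1
    · right; right; left
      apply sq_eq
      change y ^ 2 = x ^ 2
      field_simp at g1
      linear_combination g1
    rcases eq_or_mul_eq_one_of_add_inv_eq hB hC f2 with g2 | g2
    · left; left
      have q1 : s = -(k * s) := by
        apply sq_mul
        change u ^ 2 * v ^ 2 = 1
        field_simp at g1
        linear_combination g1
      have q2 : s = k * s := by
        apply sq_eq
        change u ^ 2 = v ^ 2
        field_simp at g2
        linear_combination g2
      rw [← q2] at q1
      exact eq_zero_of_eq_neg_of_odd hn q1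
    · right; right; right
      apply sq_mul
      change y ^ 2 * x ^ 2 = 1
      field_simp at g2
      linear_combination g2

theorem sum_rootChar_mul (b : ZMod n) :
    ∑ i : ZMod n, rootChar hω (i * b) = if b = 0 then (n : ℂ) else 0 := by
  have := AddChar.sum_mulShift b (AddChar.zmodChar_primitive_of_primitive_root n hω)
  rw [ZMod.card] at this
  exact_mod_cast this

theorem sum_rootChar_mul_shift (w : ZMod n → ℂ) (s d : ZMod n) :
    ∑ i, rootChar hω (-(s * i)) * w (i + d) =
      rootChar hω (s * d) * ∑ i, rootChar hω (-(s * i)) * w i := by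
  rw [Finset.mul_sum, ← Equiv.sum_comp (Equiv.addRight d)
    fun i => rootChar hω (s * d) * (rootChar hω (-(s * i)) * w i)]
  refine Finset.sum_congr rfl fun i _ => ?_
  rw [← mul_assoc, ← AddChar.map_add_eq_mul]
  simp only [Equiv.coe_addRight]
  congr 2
  ring

/-- Fourier inversion. -/
theorem sum_rootChar_mul_sum (w : ZMod n → ℂ) (i : ZMod n) :
    ∑ s, rootChar hω (s * i) * ∑ j, rootChar hω (-(s * j)) * w j = n * w i := by
  have : ∀ s, rootChar hω (s * i) * ∑ j, rootChar hω (-(s * j)) * w j =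
      ∑ j, rootChar hω (s * (i - j)) * w j := by
    intro s
    rw [Finset.mul_sum]
    refine Finset.sum_congr rfl fun j _ => ?_
    rw [← mul_assoc, ← AddChar.map_add_eq_mul]
    congr 2
    ring
  simp_rw [this]
  rw [Finset.sum_comm]
  simp_rw [← Finset.sum_mul, sum_rootChar_mul, sub_eq_zero]
  simp

/-- The circulant system that describes the infinitesimal loxogon deformations of the regular
polygon has only the obvious solutions. -/
theorem circulant_solution (hn : Odd n) {k : ZMod n} (hk0 : k ≠ 0) (hk1 : k ≠ 1) (hk2 : k ≠ -1)
    (w : ZMod n → ℂ) (C : ℂ)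
    (hw : ∀ i, (w i - rootChar hω k * w (i + k)) / (1 - rootChar hω k) +
        (w (i + 1) - rootChar hω k * w (i + k + 1)) / (1 - rootChar hω k) -
        (w i - rootChar hω (k + 1) * w (i + k + 1)) / (1 - rootChar hω (k + 1)) -
        (rootChar hω 1 * w (i + 1) - rootChar hω k * w (i + k)) /
          (rootChar hω 1 - rootChar hω k) = C) :
    ∃ a b c : ℂ, ∀ i, w i = a + b * rootChar hω i + c * rootChar hω (-i) := by
  have hy : 1 - rootChar hω k ≠ 0 := by
    rw [sub_ne_zero, ← AddChar.map_zero_eq_one (rootChar hω)]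
    exact fun h => hk0 (rootChar_injective hω h).symm
  have hxy : 1 - rootChar hω (k + 1) ≠ 0 := by
    rw [sub_ne_zero, ← AddChar.map_zero_eq_one (rootChar hω)]
    exact fun h => hk2 (eq_neg_of_add_eq_zero_left (rootChar_injective hω h).symm)
  have hxmy : rootChar hω 1 - rootChar hω k ≠ 0 := by
    rw [sub_ne_zero]
    exact fun h => hk1 (rootChar_injective hω h).symm
  have h10 : (1 : ZMod n) ≠ 0 := fun h => hk0 (by rw [← mul_one k, h, mul_zero])
  have hx1 : 1 - rootChar hω 1 ≠ 0 := by
    rw [sub_ne_zero, ← AddChar.map_zero_eq_one (rootChar hω)]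
    exact fun h => h10 (rootChar_injective hω h).symm
  set W : ZMod n → ℂ := fun s => ∑ j, rootChar hω (-(s * j)) * w j with hW
  have hzero : ∀ s, s ≠ 0 → s ≠ 1 → s ≠ -1 → W s = 0 := by
    intro s h0 h1 h2
    by_contra hWs
    -- The unknown constant `C` contributes only to frequency `0`.
    have hsum : ∑ i, rootChar hω (-(s * i)) * C = 0 := by
      rw [← Finset.sum_mul]
      have := sum_rootChar_mul hω (-s)
      rw [if_neg (neg_ne_zero.2 h0)] at this
      refine mul_eq_zero_of_left (Eq.trans ?_ this) C
      exact Finset.sum_congr rfl fun i _ => by congr 1; ring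
    have e0 : ∑ i, rootChar hω (-(s * i)) * w i = W s := rfl
    have e1 := sum_rootChar_mul_shift hω w s 1
    have e2 := sum_rootChar_mul_shift hω w s k
    have e3 := sum_rootChar_mul_shift hω w s (k + 1)
    rw [e0] at e1 e2 e3
    have hlam : (W s - rootChar hω k * (rootChar hω (s * k) * W s)) / (1 - rootChar hω k) +
        (rootChar hω (s * 1) * W s - rootChar hω k * (rootChar hω (s * (k + 1)) * W s)) /
          (1 - rootChar hω k) -
        (W s - rootChar hω (k + 1) * (rootChar hω (s * (k + 1)) * W s)) /
          (1 - rootChar hω (k + 1)) -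
        (rootChar hω 1 * (rootChar hω (s * 1) * W s) -
          rootChar hω k * (rootChar hω (s * k) * W s)) /
          (rootChar hω 1 - rootChar hω k) = 0 := by
      rw [← hsum, ← e1, ← e2, ← e3, ← e0]
      simp only [Finset.mul_sum, ← Finset.sum_sub_distrib, Finset.sum_div,
        ← Finset.sum_add_distrib]
      refine Finset.sum_congr rfl fun i _ => ?_
      rw [← hw i, ← add_assoc i k 1]
      ring
    rw [mul_one, mul_add, mul_one, AddChar.map_add_eq_mul, AddChar.map_add_eq_mul,
      mul_comm s k] at hlam
    rw [AddChar.map_add_eq_mul] at hxy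
    have hx0 := rootChar_ne_zero hω 1
    have hy0 := rootChar_ne_zero hω k
    have key := tan_equation hω hn k s ?_
    · tauto
    set x := rootChar hω 1
    set y := rootChar hω k
    set u := rootChar hω s
    set v := rootChar hω (k * s)
    field_simp at hlam
    rw [mul_zero] at hlam
    -- The numerator of the eigenvalue at frequency `s` factors, with the tangent equation as the
    -- only factor that can vanish.
    have hfac : y * (1 - x) * ((y * u + 1) * (v + x) - (x * v + 1) * (y + u)) = 0 := by
      linear_combination (mul_eq_zero.1 hlam).resolve_left hWs
    exact sub_eq_zero.1 ((mul_eq_zero.1 hfac).resolve_left (mul_ne_zero hy0 hx1))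
  refine ⟨(n : ℂ)⁻¹ * W 0, (n : ℂ)⁻¹ * W 1, (n : ℂ)⁻¹ * W (-1), fun i => ?_⟩
  have hn0 : (n : ℂ) ≠ 0 := Nat.cast_ne_zero.2 (NeZero.ne n)
  have hinv := sum_rootChar_mul_sum hω w i
  have hsupp : ∑ s, rootChar hω (s * i) * W s =
      ∑ s ∈ {0, 1, -1}, rootChar hω (s * i) * W s := by
    symm
    apply Finset.sum_subset (Finset.subset_univ _)
    intro s _ hs
    simp only [Finset.mem_insert, Finset.mem_singleton, not_or] at hs
    rw [hzero s hs.1 hs.2.1 hs.2.2, mul_zero]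
  change ∑ s, rootChar hω (s * i) * W s = n * w i at hinv
  have h11 : (1 : ZMod n) ≠ -1 := fun h => h10 (eq_zero_of_eq_neg_of_odd hn h)
  rw [hsupp, Finset.sum_insert (by simp [h10, h10.symm]), Finset.sum_insert (by simpa using h11),
    Finset.sum_singleton, zero_mul, AddChar.map_zero_eq_one, one_mul, one_mul, neg_one_mul]
    at hinv
  field_simp
  linear_combination -hinv

end RootOfUnity

/-! ### Algebra of the bracket. -/

section Bracket

variable {F : Type*} [Field F]

@[simp] theorem bracket_self (a : Fin 2 → F) : bracket a a = 0 := by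
  unfold bracket; ring

theorem bracket_swap (a b : Fin 2 → F) : bracket b a = -bracket a b := by
  unfold bracket; ring

@[simp] theorem bracket_add_left (a b c : Fin 2 → F) :
    bracket (a + b) c = bracket a c + bracket b c := by
  simp only [bracket, Pi.add_apply]; ring

@[simp] theorem bracket_add_right (a b c : Fin 2 → F) :
    bracket a (b + c) = bracket a b + bracket a c := by
  simp only [bracket, Pi.add_apply]; ring

@[simp] theorem bracket_sub_left (a b c : Fin 2 → F) :
    bracket (a - b) c = bracket a c - bracket b c := by
  simp only [bracket, Pi.sub_apply]; ring

@[simp] theorem bracket_sub_right (a b c : Fin 2 → F) :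
    bracket a (b - c) = bracket a b - bracket a c := by
  simp only [bracket, Pi.sub_apply]; ring

@[simp] theorem bracket_smul_left (r : F) (a b : Fin 2 → F) :
    bracket (r • a) b = r * bracket a b := by
  simp only [bracket, Pi.smul_apply, smul_eq_mul]; ring

@[simp] theorem bracket_smul_right (r : F) (a b : Fin 2 → F) :
    bracket a (r • b) = r * bracket a b := by
  simp only [bracket, Pi.smul_apply, smul_eq_mul]; ring

theorem bracket_mulVec (M : Matrix (Fin 2) (Fin 2) F) (a b : Fin 2 → F) :
    bracket (M.mulVec a) (M.mulVec b) = M.det * bracket a b := by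
  simp only [bracket, Matrix.mulVec, dotProduct, Fin.sum_univ_two, Matrix.det_fin_two]
  ring

theorem bracket_mulVec_add (M : Matrix (Fin 2) (Fin 2) F) (a b : Fin 2 → F) :
    bracket (M.mulVec a) b + bracket a (M.mulVec b) = M.trace * bracket a b := by
  simp only [bracket, Matrix.mulVec, dotProduct, Fin.sum_univ_two, Matrix.trace_fin_two]
  ring

theorem bracket_map {F' : Type*} [Field F'] (φ : F →+* F') (a b : Fin 2 → F) :
    bracket (φ ∘ a) (φ ∘ b) = φ (bracket a b) := by
  simp [bracket]

/-- Every vector is a combination of two independent ones. -/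
theorem bracket_smul_eq (a b x : Fin 2 → F) :
    bracket a b • x = bracket x b • a + bracket a x • b := by
  ext j
  fin_cases j <;> simp [bracket] <;> ring

theorem exists_eq_smul_of_bracket_eq_zero {a x : Fin 2 → F} (ha : a ≠ 0) (h : bracket a x = 0) :
    ∃ c : F, x = c • a := by
  have h' : a 0 * x 1 = a 1 * x 0 := sub_eq_zero.1 h
  by_cases h0 : a 0 = 0
  · have h1 : a 1 ≠ 0 := by
      intro h1
      apply ha
      ext j
      fin_cases j <;> simp [h0, h1]
    have hx : x 0 = 0 := by
      rw [h0, zero_mul] at h'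
      exact (mul_eq_zero.1 h'.symm).resolve_left h1
    refine ⟨x 1 / a 1, ?_⟩
    ext j
    fin_cases j
    · simp [h0, hx]
    · simp [h1]
  · refine ⟨x 0 / a 0, ?_⟩
    ext j
    fin_cases j
    · simp [h0]
    · simp only [Fin.mk_one, Pi.smul_apply, smul_eq_mul]
      field_simp
      linear_combination h'

end Bracket

/-! ### Logarithmic derivatives of brackets and cross-ratios. -/

section LogDeriv

variable {F : Type*} [Field F] {n : ℕ}

/-- The logarithmic derivative of `bracket (P i) (P j)` in the direction of `V`. -/
def bracketLogDeriv (P V : ZMod n → Fin 2 → F) (i j : ZMod n) : F :=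
  (bracket (V i) (P j) + bracket (P i) (V j)) / bracket (P i) (P j)

/-- The logarithmic derivative of the cross-ratio of `P i`, `P (i + 1)`, `P (i + k)`,
`P (i + k + 1)` in the direction of `V`. -/
def crossRatioLogDeriv (k : ZMod n) (P V : ZMod n → Fin 2 → F) (i : ZMod n) : F :=
  bracketLogDeriv P V i (i + k) + bracketLogDeriv P V (i + 1) (i + k + 1) -
    bracketLogDeriv P V i (i + k + 1) - bracketLogDeriv P V (i + 1) (i + k)

theorem bracketLogDeriv_sub (P V W : ZMod n → Fin 2 → F) (i j : ZMod n) :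
    bracketLogDeriv P (V - W) i j = bracketLogDeriv P V i j - bracketLogDeriv P W i j := by
  simp only [bracketLogDeriv, Pi.sub_apply, bracket_sub_left, bracket_sub_right]
  ring

theorem crossRatioLogDeriv_sub (k : ZMod n) (P V W : ZMod n → Fin 2 → F) (i : ZMod n) :
    crossRatioLogDeriv k P (V - W) i = crossRatioLogDeriv k P V i - crossRatioLogDeriv k P W i := by
  simp only [crossRatioLogDeriv, bracketLogDeriv_sub]
  ring

theorem bracketLogDeriv_map {F' : Type*} [Field F'] (φ : F →+* F') (P V : ZMod n → Fin 2 → F)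
    (i j : ZMod n) :
    bracketLogDeriv (fun i => φ ∘ P i) (fun i => φ ∘ V i) i j = φ (bracketLogDeriv P V i j) := by
  simp [bracketLogDeriv, bracket_map]

theorem crossRatioLogDeriv_map {F' : Type*} [Field F'] (φ : F →+* F') (k : ZMod n)
    (P V : ZMod n → Fin 2 → F) (i : ZMod n) :
    crossRatioLogDeriv k (fun i => φ ∘ P i) (fun i => φ ∘ V i) i =
      φ (crossRatioLogDeriv k P V i) := by
  simp [crossRatioLogDeriv, bracketLogDeriv_map]

theorem bracketLogDeriv_smul_mulVec {M : Matrix (Fin 2) (Fin 2) F} (hM : M.det ≠ 0)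
    {l : ZMod n → F} (hl : ∀ i, l i ≠ 0) (P V : ZMod n → Fin 2 → F) (i j : ZMod n) :
    bracketLogDeriv (fun i => l i • M.mulVec (P i)) (fun i => l i • M.mulVec (V i)) i j =
      bracketLogDeriv P V i j := by
  have h : l i * l j * M.det ≠ 0 := mul_ne_zero (mul_ne_zero (hl i) (hl j)) hM
  simp only [bracketLogDeriv, bracket_smul_left, bracket_smul_right, bracket_mulVec]
  rw [← mul_div_mul_left _ (bracket (P i) (P j)) h]
  congr 1 <;> ring

/-- In `crossRatioLogDeriv` the trace and every `c i` occur twice with opposite signs, so trivial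
deformations preserve the cross-ratios. -/
theorem bracketLogDeriv_of_trivial {P V : ZMod n → Fin 2 → F} {A : Matrix (Fin 2) (Fin 2) F}
    {c : ZMod n → F} (hV : ∀ i, V i = A.mulVec (P i) + c i • P i) {i j : ZMod n}
    (hij : bracket (P i) (P j) ≠ 0) :
    bracketLogDeriv P V i j = A.trace + c i + c j := by
  rw [bracketLogDeriv, div_eq_iff hij, hV, hV]
  simp only [bracket_add_left, bracket_add_right, bracket_smul_left, bracket_smul_right]
  linear_combination bracket_mulVec_add A (P i) (P j)

end LogDeriv

/-! ### Infinitesimal rigidity for the roots of unity. -/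

section Circle

variable {n : ℕ} [NeZero n] {ω : ℂ} (hω : IsPrimitiveRoot ω n)

/-- The vertices of the regular polygon on the unit circle of the complex plane. -/
noncomputable def rootVec (i : ZMod n) : Fin 2 → ℂ := ![rootChar hω i, 1]

theorem bracket_rootVec (i j : ZMod n) :
    bracket (rootVec hω i) (rootVec hω j) = rootChar hω i - rootChar hω j := by
  simp [bracket, rootVec]

theorem rootVec_rigid (hn : Odd n) {k : ZMod n} (hk0 : k ≠ 0) (hk1 : k ≠ 1) (hk2 : k ≠ -1)
    (U : ZMod n → Fin 2 → ℂ) (C : ℂ)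
    (hU : ∀ i, crossRatioLogDeriv k (rootVec hω) U i = C)
    (h0 : bracket (rootVec hω 0) (U 0) = 0) (h1 : bracket (rootVec hω 1) (U 1) = 0)
    (h2 : bracket (rootVec hω 2) (U 2) = 0) (i : ZMod n) :
    bracket (rootVec hω i) (U i) = 0 := by
  -- The affine coordinate `z` of vertex `i` has velocity `U i 0 - z * U i 1`; dividing it by `z`
  -- makes the system invariant under rotation.
  set w : ZMod n → ℂ := fun i => (rootChar hω i)⁻¹ * U i 0 - U i 1 with hw
  have hbr : ∀ i, bracket (rootVec hω i) (U i) = -(rootChar hω i * w i) := by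
    intro i
    have := rootChar_ne_zero hω i
    simp only [bracket, rootVec, hw, Matrix.cons_val_zero, Matrix.cons_val_one]
    field_simp
    ring
  have hne : ∀ {i j : ZMod n}, i ≠ j → rootChar hω i - rootChar hω j ≠ 0 := fun hij h =>
    hij (rootChar_injective hω (sub_eq_zero.1 h))
  have hlog : ∀ i j, i ≠ j → bracketLogDeriv (rootVec hω) U i j =
      U i 1 + U j 1 + (rootChar hω i * w i - rootChar hω j * w j) /
        (rootChar hω i - rootChar hω j) := by
    intro i j hij
    have hi := rootChar_ne_zero hω i
    have hj := rootChar_ne_zero hω j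
    have h := hne hij
    simp only [bracketLogDeriv, bracket, rootVec, hw, Matrix.cons_val_zero, Matrix.cons_val_one]
    have h' : rootChar hω i * 1 - 1 * rootChar hω j ≠ 0 := by simpa using h
    field_simp
    ring
  obtain ⟨a, b, c, habc⟩ := circulant_solution hω hn hk0 hk1 hk2 w C (by
    intro i
    have e := hU i
    have n1 : i ≠ i + k := by simpa using hk0
    have n2 : i + 1 ≠ i + k + 1 := by simpa using hk0
    have n3 : i ≠ i + k + 1 := by
      rw [add_assoc, ne_eq, left_eq_add]
      exact fun h => hk2 (eq_neg_of_add_eq_zero_left h)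
    have n4 : i + 1 ≠ i + k := by simpa using hk1.symm
    rw [crossRatioLogDeriv, hlog _ _ n1, hlog _ _ n2, hlog _ _ n3, hlog _ _ n4] at e
    rw [← e]
    have i0 := rootChar_ne_zero hω i
    have x0 := rootChar_ne_zero hω 1
    have m1 := hne hk0.symm
    have m2 := hne hk1.symm
    have m3 : rootChar hω 0 - rootChar hω (k + 1) ≠ 0 :=
      hne fun h => hk2 (eq_neg_of_add_eq_zero_left h.symm)
    simp only [AddChar.map_add_eq_mul, AddChar.map_zero_eq_one] at m1 m2 m3 ⊢
    -- Pulling out `rootChar hω i` leaves coefficients independent of `i`; the terms `U i 1` have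
    -- cancelled.
    have q1 : rootChar hω i - rootChar hω i * rootChar hω k =
      rootChar hω i * (1 - rootChar hω k) := by ring
    have q2 : rootChar hω i * rootChar hω 1 - rootChar hω i * rootChar hω k * rootChar hω 1 =
      rootChar hω i * rootChar hω 1 * (1 - rootChar hω k) := by ring
    have q3 : rootChar hω i - rootChar hω i * rootChar hω k * rootChar hω 1 =
      rootChar hω i * (1 - rootChar hω k * rootChar hω 1) := by ring
    have q4 : rootChar hω i * rootChar hω 1 - rootChar hω i * rootChar hω k =
      rootChar hω i * (rootChar hω 1 - rootChar hω k) := by ring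
    rw [q1, q2, q3, q4]
    field_simp
    ring)
  have h10 : (1 : ZMod n) ≠ 0 := fun h => hk0 (by rw [← mul_one k, h, mul_zero])
  have h20 : (2 : ZMod n) ≠ 0 := fun h =>
    h10 (eq_zero_of_eq_neg_of_odd hn (by linear_combination h))
  have h21 : (2 : ZMod n) ≠ 1 := fun h => h10 (by linear_combination h)
  have hquad : ∀ i, rootChar hω i * w i =
      b * rootChar hω i ^ 2 + a * rootChar hω i + c := by
    intro i
    have hi := rootChar_ne_zero hω i
    rw [habc, AddChar.map_neg_eq_inv]
    field_simp
    ring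
  rw [hbr, neg_eq_zero, hquad] at h0 h1 h2
  have d1 := hne h10
  have d2 := hne h20
  have d3 := hne h21
  rw [hbr, neg_eq_zero, hquad]
  set z0 := rootChar hω 0
  set z1 := rootChar hω 1
  set z2 := rootChar hω 2
  -- The velocity is a quadratic polynomial in `z` with the three distinct zeros `z0, z1, z2`;
  -- divided differences show that it vanishes.
  have e1 : b * (z1 + z0) + a = 0 := by
    refine (mul_eq_zero.1 (?_ : (z1 - z0) * (b * (z1 + z0) + a) = 0)).resolve_left d1
    linear_combination h1 - h0
  have e2 : b * (z2 + z0) + a = 0 := by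
    refine (mul_eq_zero.1 (?_ : (z2 - z0) * (b * (z2 + z0) + a) = 0)).resolve_left d2
    linear_combination h2 - h0
  have hb : b = 0 := by
    refine (mul_eq_zero.1 (?_ : (z2 - z1) * b = 0)).resolve_left d3
    linear_combination e2 - e1
  have ha : a = 0 := by rw [hb] at e1; simpa using e1
  have hc : c = 0 := by rw [hb, ha] at h0; simpa using h0
  rw [ha, hb, hc]
  ring

end Circle

/-! ### Transfer from regular polygons over `K` to roots of unity. -/

section Regular

variable {K : Type*} [RCLike K] {n : ℕ} [NeZero n]

theorem exists_ringHom_complex (K : Type*) [RCLike K] :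
    ∃ φ : K →+* ℂ, ∀ x : ℝ, φ (x : K) = (x : ℂ) := by
  rcases RCLike.I_eq_zero_or_im_I_eq_one (K := K) with h | h
  · exact ⟨Complex.ofRealHom.comp (RCLike.realRingEquiv h).toRingHom, fun x => by
      simp [RCLike.realRingEquiv]⟩
  · exact ⟨(RCLike.complexRingEquiv h).toRingHom, fun x => by simp [RCLike.complexRingEquiv]⟩

/-- The matrix is a Cayley transform taking the unit circle to the real projective line. The angle
doubles, so `π m j / n` corresponds to an `n`-th root of unity. -/
theorem cos_sin_eq_smul_mulVec (x : ℝ) :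
    (![(Real.cos x : ℂ), (Real.sin x : ℂ)] : Fin 2 → ℂ) =
      Complex.exp (-(x * Complex.I)) •
        (!![1 / 2, 1 / 2; -Complex.I / 2, Complex.I / 2] : Matrix (Fin 2) (Fin 2) ℂ).mulVec
          ![Complex.exp (2 * (x * Complex.I)), 1] := by
  have h : Complex.exp (-(x * Complex.I)) * Complex.exp (2 * (x * Complex.I)) =
      Complex.exp (x * Complex.I) := by
    rw [← Complex.exp_add]
    congr 1
    ring
  ext j
  fin_cases j
  · simp [Complex.cos]
    linear_combination -h / 2
  · simp [Complex.sin]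
    linear_combination Complex.I * h / 2

/-- Over the complex numbers, the vertices of a regular polygon can be taken to be the roots of
unity. -/
theorem exists_rootVec_coords {P : ZMod n → Fin 2 → K} {hP : ∀ i, P i ≠ 0}
    (hreg : IsProjRegular (ofVectors P hP)) :
    ∃ (φ : K →+* ℂ) (ω : ℂ) (hω : IsPrimitiveRoot ω n) (M : Matrix (Fin 2) (Fin 2) ℂ)
      (l : ZMod n → ℂ), M.det ≠ 0 ∧ (∀ i, l i ≠ 0) ∧
        ∀ i, φ ∘ P i = l i • M.mulVec (rootVec hω i) := by
  obtain ⟨φ, hφ⟩ := exists_ringHom_complex K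
  obtain ⟨m, hm, g, hg⟩ := hreg
  have hn0 : (n : ℂ) ≠ 0 := Nat.cast_ne_zero.2 (NeZero.ne n)
  have hω := Complex.isPrimitiveRoot_exp_of_coprime m n (NeZero.ne n) hm
  set N : Matrix (Fin 2) (Fin 2) ℂ := !![1 / 2, 1 / 2; -Complex.I / 2, Complex.I / 2]
  set G : Matrix (Fin 2) (Fin 2) K := LinearMap.toMatrix' (g : (Fin 2 → K) →ₗ[K] (Fin 2 → K))
  have hpt : ∀ i : ZMod n, ∃ l : ℂ, l ≠ 0 ∧
      φ ∘ P i = l • ((G.map φ) * N).mulVec (rootVec hω i) := by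
    intro i
    have h := hg i.val
    rw [ZMod.natCast_zmod_val, anglePoint, Projectivization.smul_mk, ofVectors,
      Projectivization.mk_eq_mk_iff] at h
    obtain ⟨a, ha⟩ := h
    set x : ℝ := Real.pi * m * i.val / n
    refine ⟨φ a * Complex.exp (-(x * Complex.I)), mul_ne_zero ?_ (Complex.exp_ne_zero _), ?_⟩
    · exact (map_ne_zero φ).2 a.ne_zero
    have hexp : Complex.exp (2 * (x * Complex.I)) = rootChar hω i := by
      rw [AddChar.zmodChar_apply, ← Complex.exp_nat_mul]
      congr 1
      simp only [x]
      push_cast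
      field_simp
    have hgv : g • (![(Real.cos x : K), (Real.sin x : K)] : Fin 2 → K) =
        G.mulVec ![(Real.cos x : K), (Real.sin x : K)] := by
      rw [LinearMap.toMatrix'_mulVec]
      rfl
    have hcs : φ ∘ ![(Real.cos x : K), (Real.sin x : K)] =
        Complex.exp (-(x * Complex.I)) • N.mulVec (rootVec hω i) := by
      rw [rootVec, ← hexp, ← cos_sin_eq_smul_mulVec]
      ext j
      fin_cases j <;> simp [hφ]
    rw [← ha, hgv, ← Matrix.mulVec_mulVec, mul_smul, ← Matrix.mulVec_smul (G.map φ), ← hcs]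
    ext j
    simp only [Function.comp_apply, Pi.smul_apply, Units.smul_def, smul_eq_mul, map_mul,
      RingHom.map_mulVec]
  choose l hl hlP using hpt
  refine ⟨φ, _, hω, G.map φ * N, l, ?_, hl, hlP⟩
  rw [Matrix.det_mul]
  refine mul_ne_zero ?_ ?_
  · have : (G.map φ).det = φ G.det := (RingHom.map_det φ G).symm
    rw [this, map_ne_zero, LinearMap.det_toMatrix']
    exact (LinearMap.isUnit_det _ g.isUnit).ne_zero
  · simp only [N, Matrix.det_fin_two_of]
    ring_nf
    simp

theorem bracket_ne_zero_of_regular {P : ZMod n → Fin 2 → K} {hP : ∀ i, P i ≠ 0}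
    (hreg : IsProjRegular (ofVectors P hP)) {i j : ZMod n} (hij : i ≠ j) :
    bracket (P i) (P j) ≠ 0 := by
  obtain ⟨φ, ω, hω, M, l, hM, hl, h⟩ := exists_rootVec_coords hreg
  rw [← map_ne_zero φ, ← bracket_map, h, h]
  simp only [bracket_smul_left, bracket_smul_right, bracket_mulVec, bracket_rootVec]
  exact mul_ne_zero (hl j) (mul_ne_zero (hl i) (mul_ne_zero hM
    (sub_ne_zero.2 fun e => hij (rootChar_injective hω e))))

theorem vecCrossRatio_eq_of_regular {P : ZMod n → Fin 2 → K} {hP : ∀ i, P i ≠ 0}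
    (hreg : IsProjRegular (ofVectors P hP)) {k : ZMod n} (hk1 : k ≠ 1) (hk2 : k ≠ -1)
    (i : ZMod n) :
    vecCrossRatio (P i) (P (i + 1)) (P (i + k)) (P (i + k + 1)) =
      vecCrossRatio (P 0) (P (0 + 1)) (P (0 + k)) (P (0 + k + 1)) := by
  have n3 : ∀ i : ZMod n, i ≠ i + k + 1 := fun i => by
    rw [add_assoc, ne_eq, left_eq_add]
    exact fun h => hk2 (eq_neg_of_add_eq_zero_left h)
  have n4 : ∀ i : ZMod n, i + 1 ≠ i + k := fun i => by simpa using hk1.symm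
  have b3 := fun i => bracket_ne_zero_of_regular hreg (n3 i)
  have b4 := fun i => bracket_ne_zero_of_regular hreg (n4 i)
  unfold vecCrossRatio
  rw [div_eq_div_iff (mul_ne_zero (b3 _) (b4 _)) (mul_ne_zero (b3 _) (b4 _))]
  obtain ⟨φ, ω, hω, M, l, hM, hl, h⟩ := exists_rootVec_coords hreg
  apply φ.injective
  simp only [map_mul, ← bracket_map, h, bracket_smul_left, bracket_smul_right, bracket_mulVec,
    bracket_rootVec, AddChar.map_add_eq_mul, AddChar.map_zero_eq_one]
  ring

theorem regular_rigid (hn : Odd n) {P : ZMod n → Fin 2 → K} {hP : ∀ i, P i ≠ 0}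
    (hreg : IsProjRegular (ofVectors P hP)) {k : ZMod n} (hk0 : k ≠ 0) (hk1 : k ≠ 1)
    (hk2 : k ≠ -1) {V : ZMod n → Fin 2 → K} {C : K}
    (hV : ∀ i, crossRatioLogDeriv k P V i = C) (h0 : bracket (P 0) (V 0) = 0)
    (h1 : bracket (P 1) (V 1) = 0) (h2 : bracket (P 2) (V 2) = 0) (i : ZMod n) :
    bracket (P i) (V i) = 0 := by
  obtain ⟨φ, ω, hω, M, l, hM, hl, h⟩ := exists_rootVec_coords hreg
  set U : ZMod n → Fin 2 → ℂ := fun i => (l i)⁻¹ • M⁻¹.mulVec (φ ∘ V i)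
  have hU : ∀ i, φ ∘ V i = l i • M.mulVec (U i) := by
    intro i
    rw [Matrix.mulVec_smul, smul_smul, mul_inv_cancel₀ (hl i), one_smul, Matrix.mulVec_mulVec,
      Matrix.mul_nonsing_inv _ (isUnit_iff_ne_zero.2 hM), Matrix.one_mulVec]
  have hbr : ∀ i, bracket (P i) (V i) = 0 ↔ bracket (rootVec hω i) (U i) = 0 := by
    intro i
    rw [← map_eq_zero φ, ← bracket_map, h, hU]
    rw [bracket_smul_left, bracket_smul_right, bracket_mulVec]
    simp [hM, hl]
  rw [hbr] at h0 h1 h2 ⊢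
  refine rootVec_rigid hω hn hk0 hk1 hk2 U (φ C) (fun i => ?_) h0 h1 h2 i
  rw [← hV i, ← crossRatioLogDeriv_map, funext h, funext hU]
  simp only [crossRatioLogDeriv, bracketLogDeriv_smul_mulVec hM hl]

end Regular

/-- Traceless matrices `A` correspond to binary quadratic forms `x ↦ bracket x (A.mulVec x)`, so
this is Lagrange interpolation at three points of the projective line. -/
theorem exists_trace_zero_bracket_mulVec {F : Type*} [Field F] [CharZero F] {p q r : Fin 2 → F}
    (hpq : bracket p q ≠ 0) (hpr : bracket p r ≠ 0) (hqr : bracket q r ≠ 0) (a b c : F) :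
    ∃ A : Matrix (Fin 2) (Fin 2) F, A.trace = 0 ∧ bracket p (A.mulVec p) = a ∧
      bracket q (A.mulVec q) = b ∧ bracket r (A.mulVec r) = c := by
  -- `E u v` represents the form `bracket u x * bracket v x`, with zeros at `u` and `v`.
  set E : (Fin 2 → F) → (Fin 2 → F) → Matrix (Fin 2) (Fin 2) F := fun u v =>
    !![(u 0 * v 1 + u 1 * v 0) / 2, -(u 0 * v 0); u 1 * v 1, -((u 0 * v 1 + u 1 * v 0) / 2)]
    with hE
  have htr : ∀ u v, (E u v).trace = 0 := by
    intro u v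
    simp [hE, Matrix.trace_fin_two_of]
  have hbr : ∀ u v x, bracket x ((E u v).mulVec x) = bracket u x * bracket v x := by
    intro u v x
    simp only [hE, bracket, Matrix.mulVec, dotProduct, Fin.sum_univ_two, Matrix.of_apply,
      Matrix.cons_val_zero, Matrix.cons_val_one, Matrix.cons_val']
    simp
    ring
  refine ⟨(a / (bracket q p * bracket r p)) • E q r + (b / (bracket p q * bracket r q)) • E p r +
    (c / (bracket p r * bracket q r)) • E p q, ?_, ?_, ?_, ?_⟩
  · simp [htr]
  all_goals
    simp only [Matrix.add_mulVec, Matrix.smul_mulVec, bracket_add_right, bracket_smul_right, hbr,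
      bracket_self]
    rw [bracket_swap p q, bracket_swap p r, bracket_swap q r]
    field_simp
    ring

/-! ### Infinitesimal rigidity, and isolation in a slice. -/

section Deriv

variable {K : Type*} [RCLike K] {n : ℕ}

theorem hasDerivAt_bracket_line (a a' b b' : Fin 2 → K) :
    HasDerivAt (fun t : K => bracket (a + t • a') (b + t • b')) (bracket a' b + bracket a b') 0 := by
  have h : ∀ (x y : K), HasDerivAt (fun t : K => x + t * y) y 0 := fun x y => by
    simpa using ((hasDerivAt_id (0 : K)).mul_const y).const_add x
  have := ((h (a 0) (a' 0)).mul (h (b 1) (b' 1))).sub ((h (a 1) (a' 1)).mul (h (b 0) (b' 0)))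
  refine HasDerivAt.congr_deriv this ?_
  simp only [bracket]
  ring

theorem hasDerivAt_vecCrossRatio_line {k : ZMod n} {P : ZMod n → Fin 2 → K}
    (V : ZMod n → Fin 2 → K) {i : ZMod n} (h1 : bracket (P i) (P (i + k)) ≠ 0)
    (h2 : bracket (P (i + 1)) (P (i + k + 1)) ≠ 0) (h3 : bracket (P i) (P (i + k + 1)) ≠ 0)
    (h4 : bracket (P (i + 1)) (P (i + k)) ≠ 0) :
    HasDerivAt (fun t : K => vecCrossRatio (P i + t • V i) (P (i + 1) + t • V (i + 1))
      (P (i + k) + t • V (i + k)) (P (i + k + 1) + t • V (i + k + 1)))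
      (vecCrossRatio (P i) (P (i + 1)) (P (i + k)) (P (i + k + 1)) *
        crossRatioLogDeriv k P V i) 0 := by
  have hd := fun i j => hasDerivAt_bracket_line (P i) (V i) (P j) (V j)
  have := ((hd i (i + k)).mul (hd (i + 1) (i + k + 1))).div
    ((hd i (i + k + 1)).mul (hd (i + 1) (i + k))) (by simpa using ⟨h3, h4⟩)
  refine HasDerivAt.congr_deriv this ?_
  simp only [zero_smul, add_zero, vecCrossRatio, crossRatioLogDeriv, bracketLogDeriv, Pi.mul_apply]
  field_simp
  ring

variable [NeZero n] {P : ZMod n → Fin 2 → K} {hP : ∀ i, P i ≠ 0}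

theorem regular_hasDerivAt (hreg : IsProjRegular (ofVectors P hP)) {k : ZMod n} (hk0 : k ≠ 0)
    (hk1 : k ≠ 1) (hk2 : k ≠ -1) (V : ZMod n → Fin 2 → K) (i : ZMod n) :
    HasDerivAt (fun t : K => vecCrossRatio (P i + t • V i) (P (i + 1) + t • V (i + 1))
      (P (i + k) + t • V (i + k)) (P (i + k + 1) + t • V (i + k + 1)))
      (vecCrossRatio (P 0) (P (0 + 1)) (P (0 + k)) (P (0 + k + 1)) *
        crossRatioLogDeriv k P V i) 0 := by
  rw [← vecCrossRatio_eq_of_regular hreg hk1 hk2 i]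
  apply hasDerivAt_vecCrossRatio_line V <;> apply bracket_ne_zero_of_regular hreg
  · simpa using hk0
  · simpa using hk0
  · rw [add_assoc, ne_eq, left_eq_add]
    exact fun h => hk2 (eq_neg_of_add_eq_zero_left h)
  · simpa using hk1.symm

theorem vecCrossRatio_ne_zero_of_regular (hreg : IsProjRegular (ofVectors P hP)) {k : ZMod n}
    (hk0 : k ≠ 0) (hk1 : k ≠ 1) (hk2 : k ≠ -1) :
    vecCrossRatio (P 0) (P (0 + 1)) (P (0 + k)) (P (0 + k + 1)) ≠ 0 := by
  refine div_ne_zero (mul_ne_zero ?_ ?_) (mul_ne_zero ?_ ?_) <;>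
    apply bracket_ne_zero_of_regular hreg
  · simpa using hk0.symm
  · simpa using hk0
  · rw [add_assoc, ne_eq, left_eq_add]
    exact fun h => hk2 (eq_neg_of_add_eq_zero_left h)
  · simpa using hk1.symm

theorem regular_infinitesimal_iff (hreg : IsProjRegular (ofVectors P hP)) {k : ℕ}
    (hk0 : (k : ZMod n) ≠ 0) (hk1 : (k : ZMod n) ≠ 1) (hk2 : (k : ZMod n) ≠ -1)
    (V : ZMod n → Fin 2 → K) :
    IsInfinitesimalLoxogonDeformation k P V ↔
      ∃ C, ∀ i, crossRatioLogDeriv (k : ZMod n) P V i = C := by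
  have hα := vecCrossRatio_ne_zero_of_regular hreg hk0 hk1 hk2
  have hd := regular_hasDerivAt hreg hk0 hk1 hk2 V
  constructor
  · rintro ⟨C, hC⟩
    refine ⟨C / vecCrossRatio (P 0) (P (0 + 1)) (P (0 + k)) (P (0 + k + 1)), fun i => ?_⟩
    rw [eq_div_iff hα, mul_comm]
    exact (hd i).unique (hC i)
  · rintro ⟨C, hC⟩
    exact ⟨_, fun i => hC i ▸ hd i⟩

theorem zmod_zero_one_two_ne {n : ℕ} (hn : Odd n) (h : (1 : ZMod n) ≠ 0) :
    (0 : ZMod n) ≠ 1 ∧ (0 : ZMod n) ≠ 2 ∧ (1 : ZMod n) ≠ 2 :=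
  ⟨h.symm, fun h2 => h (eq_zero_of_eq_neg_of_odd hn (by linear_combination -h2)),
    fun h2 => h (by linear_combination -h2)⟩

/-- The regular polygon with an odd number of vertices is infinitesimally rigid. -/
theorem regular_infinitesimal_rigidity (hn : Odd n) (hreg : IsProjRegular (ofVectors P hP)) {k : ℕ}
    (hk0 : (k : ZMod n) ≠ 0) (hk1 : (k : ZMod n) ≠ 1) (hk2 : (k : ZMod n) ≠ -1)
    (V : ZMod n → Fin 2 → K) :
    IsInfinitesimalLoxogonDeformation k P V ↔ IsTrivialInfinitesimalDeformation P V := by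
  have h10 : (1 : ZMod n) ≠ 0 := fun h => hk0 (by rw [← mul_one (k : ZMod n), h, mul_zero])
  obtain ⟨n01, n02, n12⟩ := zmod_zero_one_two_ne hn h10
  have hbr := fun {i j : ZMod n} (h : i ≠ j) => bracket_ne_zero_of_regular hreg h
  have htriv : ∀ (W : ZMod n → Fin 2 → K) (A : Matrix (Fin 2) (Fin 2) K) (c : ZMod n → K),
      (∀ i, W i = A.mulVec (P i) + c i • P i) →
        ∀ i, crossRatioLogDeriv (k : ZMod n) P W i = 0 := by
    intro W A c hW i
    rw [crossRatioLogDeriv, bracketLogDeriv_of_trivial hW (hbr (by simpa using hk0)),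
      bracketLogDeriv_of_trivial hW (hbr (by simpa using hk0)),
      bracketLogDeriv_of_trivial hW (hbr ?_),
      bracketLogDeriv_of_trivial hW (hbr (by simpa using hk1.symm))]
    · ring
    · rw [add_assoc, ne_eq, left_eq_add]
      exact fun h => hk2 (eq_neg_of_add_eq_zero_left h)
  rw [regular_infinitesimal_iff hreg hk0 hk1 hk2]
  constructor
  · rintro ⟨C, hC⟩
    -- Subtracting the field of a suitable `A` reduces to a deformation that fixes vertices `0, 1,
    -- 2`.
    obtain ⟨A, hA, a0, a1, a2⟩ := exists_trace_zero_bracket_mulVec (hbr n01) (hbr n02) (hbr n12)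
      (bracket (P 0) (V 0)) (bracket (P 1) (V 1)) (bracket (P 2) (V 2))
    refine ⟨A, hA, fun i => ?_⟩
    set W : ZMod n → Fin 2 → K := fun i => A.mulVec (P i)
    have hW := htriv W A 0 (by simp [W])
    have hVW : ∀ i, bracket (P i) ((V - W) i) = bracket (P i) (V i) - bracket (P i) (W i) := by
      intro i
      rw [Pi.sub_apply, bracket_sub_right]
    have h := regular_rigid hn hreg hk0 hk1 hk2 (V := V - W) (C := C)
      (fun i => by rw [crossRatioLogDeriv_sub, hC, hW, sub_zero])
      (by rw [hVW, a0, sub_self]) (by rw [hVW, a1, sub_self]) (by rw [hVW, a2, sub_self]) i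
    obtain ⟨c, hc⟩ := exists_eq_smul_of_bracket_eq_zero (hP i) h
    exact ⟨c, by rw [← hc, Pi.sub_apply, add_sub_cancel]⟩
  · rintro ⟨A, -, hV⟩
    choose c hc using hV
    exact ⟨0, htriv V A c hc⟩

/-- The coordinates `t i` parametrize polygons near `P` up to scaling of each vector. Pinning three
of them removes the projective freedom, and `regular_rigid` then says that the linearized equations
have only the zero solution. -/
theorem regular_slice_isolated (hn : Odd n) (hreg : IsProjRegular (ofVectors P hP)) {k : ZMod n}
    (hk0 : k ≠ 0) (hk1 : k ≠ 1) (hk2 : k ≠ -1) :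
    ∀ᶠ t : ZMod n → K in 𝓝 0, t 0 = 0 → t 1 = 0 → t 2 = 0 →
      (∃ α, ∀ i, vecCrossRatio (P i + t i • P (i + 1)) (P (i + 1) + t (i + 1) • P (i + 1 + 1))
        (P (i + k) + t (i + k) • P (i + k + 1))
        (P (i + k + 1) + t (i + k + 1) • P (i + k + 1 + 1)) = α) → t = 0 := by
  have h10 : (1 : ZMod n) ≠ 0 := fun h => hk0 (by rw [← mul_one k, h, mul_zero])
  have hα := vecCrossRatio_ne_zero_of_regular hreg hk0 hk1 hk2
  set c : ZMod n → (ZMod n → K) → K := fun i t =>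
    vecCrossRatio (P i + t i • P (i + 1)) (P (i + 1) + t (i + 1) • P (i + 1 + 1))
        (P (i + k) + t (i + k) • P (i + k + 1))
        (P (i + k + 1) + t (i + k + 1) • P (i + k + 1 + 1)) with hc
  have hdiff : ∀ i, DifferentiableAt K (c i) 0 := by
    intro i
    have h3 : bracket (P i) (P (i + k + 1)) ≠ 0 := by
      apply bracket_ne_zero_of_regular hreg
      rw [add_assoc, ne_eq, left_eq_add]
      exact fun h => hk2 (eq_neg_of_add_eq_zero_left h)
    have h4 : bracket (P (i + 1)) (P (i + k)) ≠ 0 :=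
      bracket_ne_zero_of_regular hreg (by simpa using hk1.symm)
    have hb : ∀ i j : ZMod n, DifferentiableAt K (fun t : ZMod n → K =>
        bracket (P i + t i • P (i + 1)) (P j + t j • P (j + 1))) 0 := by
      intro i j
      simp only [bracket, Pi.add_apply, Pi.smul_apply, smul_eq_mul]
      fun_prop
    have hnum := (hb i (i + k)).mul (hb (i + 1) (i + k + 1))
    have hden := (hb i (i + k + 1)).mul (hb (i + 1) (i + k))
    simp only [hc, vecCrossRatio, div_eq_mul_inv]
    refine hnum.mul (hden.inv ?_)
    simpa only [Pi.mul_apply, Pi.zero_apply, zero_smul, add_zero] using mul_ne_zero h3 h4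
  -- Loxogons in the slice are zeros of `G`. The system is overdetermined, but an injective
  -- derivative suffices to isolate a zero.
  set G : (ZMod n → K) → (ZMod n → K) × K × K × K := fun t =>
    (fun i => c i t - c 0 t, t 0, t 1, t 2) with hG
  have hGd : DifferentiableAt K G 0 := by
    refine DifferentiableAt.prodMk ?_ (by fun_prop)
    exact differentiableAt_pi.2 fun i => (hdiff i).sub (hdiff 0)
  have hker : LinearMap.ker (fderiv K G 0 : (ZMod n → K) →ₗ[K] (ZMod n → K) × K × K × K) = ⊥ := by
    rw [LinearMap.ker_eq_bot']
    intro τ hτ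
    have hline : HasDerivAt (fun s : K => s • τ) τ 0 := by
      simpa using (hasDerivAt_id (0 : K)).smul_const τ
    have hGτ : HasDerivAt (fun s : K => G (s • τ)) 0 0 := by
      have h0 : HasFDerivAt G (fderiv K G 0) ((0 : K) • τ) := by
        rw [zero_smul]; exact hGd.hasFDerivAt
      have h := h0.comp_hasDerivAt (0 : K) hline
      have hτ' : fderiv K G 0 τ = 0 := hτ
      rwa [hτ'] at h
    have hproj : ∀ l : (ZMod n → K) × K × K × K →L[K] K,
        HasDerivAt (fun s : K => l (G (s • τ))) 0 0 := fun l => by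
      have h := l.hasFDerivAt.comp_hasDerivAt (0 : K) hGτ
      rwa [map_zero] at h
    have hcoord : ∀ j, HasDerivAt (fun s : K => s * τ j) (τ j) 0 := fun j => by
      simpa using (hasDerivAt_id (0 : K)).mul_const (τ j)
    have t0 : τ 0 = 0 := (hcoord 0).unique
      (hproj ((ContinuousLinearMap.fst K _ _).comp (ContinuousLinearMap.snd K _ _)))
    have t1 : τ 1 = 0 := (hcoord 1).unique
      (hproj ((ContinuousLinearMap.fst K _ _).comp
        ((ContinuousLinearMap.snd K _ _).comp (ContinuousLinearMap.snd K _ _))))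
    have t2 : τ 2 = 0 := (hcoord 2).unique
      (hproj ((ContinuousLinearMap.snd K _ _).comp
        ((ContinuousLinearMap.snd K _ _).comp (ContinuousLinearMap.snd K _ _))))
    have hcd : ∀ i, HasDerivAt (fun s : K => c i (s • τ))
        (vecCrossRatio (P 0) (P (0 + 1)) (P (0 + k)) (P (0 + k + 1)) *
          crossRatioLogDeriv k P (fun i => τ i • P (i + 1)) i) 0 := fun i => by
      simpa only [hc, Pi.smul_apply, smul_eq_mul, mul_smul] using
        regular_hasDerivAt hreg hk0 hk1 hk2 (fun i => τ i • P (i + 1)) i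
    have hlog : ∀ i, crossRatioLogDeriv k P (fun i => τ i • P (i + 1)) i =
        crossRatioLogDeriv k P (fun i => τ i • P (i + 1)) 0 := by
      intro i
      have e1 := (hcd i).sub (hcd 0)
      have e2 := hproj ((ContinuousLinearMap.proj i).comp (ContinuousLinearMap.fst K _ _))
      have e4 := e1.unique e2
      rw [← mul_sub] at e4
      exact sub_eq_zero.1 ((mul_eq_zero.1 e4).resolve_left hα)
    have h := regular_rigid hn hreg hk0 hk1 hk2 hlog (by simp [bracket, t0])
      (by simp [bracket, t1]) (by simp [bracket, t2])
    ext i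
    have hi := h i
    rw [bracket_smul_right] at hi
    exact (mul_eq_zero.1 hi).resolve_right (bracket_ne_zero_of_regular hreg (by simpa using h10))
  obtain ⟨L, -, hL⟩ := LinearMap.exists_antilipschitzWith _ hker
  have hev := hGd.hasFDerivAt.eventually_ne (c := 0) ⟨L, hL⟩
  rw [eventually_nhdsWithin_iff] at hev
  filter_upwards [hev] with t ht t0 t1 t2 ⟨α, hα⟩
  by_contra hne
  refine ht hne ?_
  have : ∀ i, c i t = α := hα
  simp only [hG, t0, t1, t2, this, sub_self]
  rfl

end Deriv

/-! ### Moving three vertices to prescribed positions. -/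

section Normalization

variable {F : Type*} [Field F] {n : ℕ}

/-- A linear map that takes the first three vertices of the polygon `Q` to those of the
polygon `P`. -/
def normalization (P Q : ZMod n → Fin 2 → F) : (Fin 2 → F) →ₗ[F] (Fin 2 → F) where
  -- `Q 0` and `Q 1` go to multiples of `P 0` and `P 1`. The constant factors are chosen so that `Q
  -- 2` goes to a multiple of `bracket (P 2) (P 1) • P 0 + bracket (P 0) (P 2) • P 1 = bracket (P 0)
  -- (P 1) • P 2`. Without denominators, the map is polynomial in `Q`.
  toFun x := (bracket x (Q 1) * (bracket (Q 0) (Q 2) * bracket (P 2) (P 1))) • P 0 +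
    (bracket (Q 0) x * (bracket (Q 2) (Q 1) * bracket (P 0) (P 2))) • P 1
  map_add' x y := by
    simp only [bracket_add_left, bracket_add_right, add_mul, add_smul]
    abel
  map_smul' r x := by
    simp only [bracket_smul_left, bracket_smul_right, smul_add, smul_smul, mul_assoc,
      RingHom.id_apply]

theorem normalization_apply (P Q : ZMod n → Fin 2 → F) (x : Fin 2 → F) :
    normalization P Q x =
      (bracket x (Q 1) * (bracket (Q 0) (Q 2) * bracket (P 2) (P 1))) • P 0 +
        (bracket (Q 0) x * (bracket (Q 2) (Q 1) * bracket (P 0) (P 2))) • P 1 := rfl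

theorem bracket_normalization (P Q : ZMod n → Fin 2 → F) (x y : Fin 2 → F) :
    bracket (normalization P Q x) (normalization P Q y) =
      bracket (Q 0) (Q 2) * bracket (P 2) (P 1) * (bracket (Q 2) (Q 1) * bracket (P 0) (P 2)) *
        bracket (P 0) (P 1) * bracket (Q 0) (Q 1) * bracket x y := by
  have h : bracket x (Q 1) * bracket (Q 0) y - bracket y (Q 1) * bracket (Q 0) x =
      bracket (Q 0) (Q 1) * bracket x y := by
    unfold bracket; ring
  simp only [normalization_apply, bracket_add_left, bracket_add_right, bracket_smul_left,
    bracket_smul_right, bracket_self, bracket_swap (P 0) (P 1)]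
  linear_combination (bracket (Q 0) (Q 2) * bracket (P 2) (P 1) * (bracket (Q 2) (Q 1) *
    bracket (P 0) (P 2)) * bracket (P 0) (P 1)) * h

theorem normalization_self (P : ZMod n → Fin 2 → F) (x : Fin 2 → F) :
    normalization P P x =
      (bracket (P 0) (P 2) * bracket (P 2) (P 1) * bracket (P 0) (P 1)) • x := by
  rw [mul_smul, bracket_smul_eq, normalization_apply, smul_add, smul_smul, smul_smul]
  congr 2 <;> ring

theorem bracket_normalization_zero (P Q : ZMod n → Fin 2 → F) :
    bracket (P 0) (normalization P Q (Q 0)) = 0 := by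
  simp [normalization_apply]

theorem bracket_normalization_one (P Q : ZMod n → Fin 2 → F) :
    bracket (P 1) (normalization P Q (Q 1)) = 0 := by
  simp [normalization_apply]

theorem bracket_normalization_two (P Q : ZMod n → Fin 2 → F) :
    bracket (P 2) (normalization P Q (Q 2)) = 0 := by
  simp only [normalization_apply, bracket_add_right, bracket_smul_right,
    bracket_swap (P 0) (P 2)]
  ring

theorem normalization_injective {P Q : ZMod n → Fin 2 → F} (hP01 : bracket (P 0) (P 1) ≠ 0)
    (hP02 : bracket (P 0) (P 2) ≠ 0) (hP21 : bracket (P 2) (P 1) ≠ 0)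
    (hQ01 : bracket (Q 0) (Q 1) ≠ 0) (hQ02 : bracket (Q 0) (Q 2) ≠ 0)
    (hQ21 : bracket (Q 2) (Q 1) ≠ 0) : Function.Injective (normalization P Q) := by
  rw [injective_iff_map_eq_zero]
  intro x hx
  have h : ∀ y, bracket x y = 0 := by
    intro y
    have h := bracket_normalization P Q x y
    rw [hx, show bracket 0 (normalization P Q y) = 0 by simp [bracket], eq_comm] at h
    exact (mul_eq_zero.1 h).resolve_left (by
      simp only [mul_ne_zero_iff]
      tauto)
  ext j
  fin_cases j
  · simpa [bracket] using h ![0, 1]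
  · simpa [bracket] using h ![1, 0]

/-- The coordinate of the `i`-th vertex of the normalized polygon on the line through `P i` in
the direction of `P (i + 1)`. -/
def sliceCoord (P Q : ZMod n → Fin 2 → F) (i : ZMod n) : F :=
  bracket (P i) (normalization P Q (Q i)) / bracket (normalization P Q (Q i)) (P (i + 1))

theorem normalization_eq_smul {P Q : ZMod n → Fin 2 → F} {i : ZMod n}
    (hP : bracket (P i) (P (i + 1)) ≠ 0)
    (hQ : bracket (normalization P Q (Q i)) (P (i + 1)) ≠ 0) :
    normalization P Q (Q i) =
      (bracket (normalization P Q (Q i)) (P (i + 1)) / bracket (P i) (P (i + 1))) •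
        (P i + sliceCoord P Q i • P (i + 1)) := by
  refine smul_right_injective _ hP ?_
  simp only
  rw [bracket_smul_eq, smul_smul, mul_div_cancel₀ _ hP, smul_add, sliceCoord, smul_smul,
    mul_div_cancel₀ _ hQ]

theorem vecCrossRatio_smul {r s t u : F} (hr : r ≠ 0) (hs : s ≠ 0) (ht : t ≠ 0) (hu : u ≠ 0)
    (a b c d : Fin 2 → F) :
    vecCrossRatio (r • a) (s • b) (t • c) (u • d) = vecCrossRatio a b c d := by
  have h : r * s * t * u ≠ 0 := by simp [hr, hs, ht, hu]
  simp only [vecCrossRatio, bracket_smul_left, bracket_smul_right]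
  rw [← mul_div_mul_left (bracket a c * bracket b d) _ h]
  congr 1 <;> ring

theorem vecCrossRatio_map {f : (Fin 2 → F) → Fin 2 → F} {δ : F} (hδ : δ ≠ 0)
    (hf : ∀ x y, bracket (f x) (f y) = δ * bracket x y) (a b c d : Fin 2 → F) :
    vecCrossRatio (f a) (f b) (f c) (f d) = vecCrossRatio a b c d := by
  simp only [vecCrossRatio, hf]
  rw [← mul_div_mul_left (bracket a c * bracket b d) _ (mul_ne_zero hδ hδ)]
  congr 1 <;> ring

theorem projEquiv_of_injective {P Q : ZMod n → Fin 2 → F} (hP : ∀ i, P i ≠ 0) (hQ : ∀ i, Q i ≠ 0)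
    (f : (Fin 2 → F) →ₗ[F] (Fin 2 → F)) (hf : Function.Injective f)
    (h : ∀ i, ∃ c : F, f (Q i) = c • P i) : ProjEquiv (ofVectors P hP) (ofVectors Q hQ) := by
  set g := LinearMap.GeneralLinearGroup.ofLinearEquiv (LinearEquiv.ofInjectiveEndo f hf)
  refine ⟨g⁻¹, fun i => ?_⟩
  rw [eq_inv_smul_iff, ofVectors, ofVectors, Projectivization.smul_mk,
    Projectivization.mk_eq_mk_iff']
  obtain ⟨c, hc⟩ := h i
  exact ⟨c, hc.symm⟩

end Normalization

/-! ### Local rigidity. -/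

section LocalRigidity

variable {K : Type*} [RCLike K] {n : ℕ} [NeZero n] {P : ZMod n → Fin 2 → K} {hP : ∀ i, P i ≠ 0}

/-- A regular polygon with an odd number of vertices has no deformations in the class of
loxogons. -/
theorem regular_local_rigidity (hn : Odd n) (hreg : IsProjRegular (ofVectors P hP)) {k : ℕ}
    (hk0 : (k : ZMod n) ≠ 0) (hk1 : (k : ZMod n) ≠ 1) (hk2 : (k : ZMod n) ≠ -1) :
    ∀ᶠ Q in 𝓝 P, ∀ hQ : ∀ i, Q i ≠ 0, IsLoxogon k (ofVectors Q hQ) →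
      ProjEquiv (ofVectors P hP) (ofVectors Q hQ) := by
  have h10 : (1 : ZMod n) ≠ 0 := fun h => hk0 (by rw [← mul_one (k : ZMod n), h, mul_zero])
  obtain ⟨n01, n02, n12⟩ := zmod_zero_one_two_ne hn h10
  have hbr := fun {i j : ZMod n} (h : i ≠ j) => bracket_ne_zero_of_regular hreg h
  have hside : ∀ i, bracket (P i) (P (i + 1)) ≠ 0 := fun i => hbr (by simpa using h10)
  have hcont : ∀ (f g : (ZMod n → Fin 2 → K) → Fin 2 → K), Continuous f → Continuous g →
      Continuous fun Q => bracket (f Q) (g Q) := by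
    intro f g hf hg
    unfold bracket
    fun_prop
  have hnorm : ∀ i, Continuous fun Q : ZMod n → Fin 2 → K => normalization P Q (Q i) := by
    intro i
    simp only [normalization_apply, bracket]
    fun_prop
  have hden : ∀ i, bracket (normalization P P (P i)) (P (i + 1)) ≠ 0 := by
    intro i
    rw [normalization_self, bracket_smul_left]
    exact mul_ne_zero (mul_ne_zero (mul_ne_zero (hbr n02) (hbr n12.symm)) (hbr n01)) (hside i)
  -- `normalization P P` is a scalar map, so `P` itself has slice coordinates `0`, and nearby `Q`
  -- have small ones.
  have hslice : Filter.Tendsto (sliceCoord P) (𝓝 P) (𝓝 (0 : ZMod n → K)) := by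
    have hP0 : sliceCoord P P = 0 := by
      ext i
      simp [sliceCoord, normalization_self]
    rw [← hP0]
    refine continuousAt_pi.2 fun i => ?_
    exact (hcont _ _ continuous_const (hnorm i)).continuousAt.div
      (hcont _ _ (hnorm i) continuous_const).continuousAt (hden i)
  have ev : ∀ i j : ZMod n, i ≠ j → ∀ᶠ Q in 𝓝 P, bracket (Q i) (Q j) ≠ 0 := fun i j hij =>
    (hcont _ _ (continuous_apply i) (continuous_apply j)).continuousAt.eventually_ne (hbr hij)
  have evden : ∀ᶠ Q in 𝓝 P, ∀ i, bracket (normalization P Q (Q i)) (P (i + 1)) ≠ 0 :=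
    Filter.eventually_all.2 fun i =>
      (hcont _ _ (hnorm i) continuous_const).continuousAt.eventually_ne (hden i)
  filter_upwards [hslice.eventually (regular_slice_isolated hn hreg hk0 hk1 hk2), ev 0 1 n01,
    ev 0 2 n02, ev 2 1 n12.symm, evden] with Q hQiso hQ01 hQ02 hQ21 hQden hQ hlox
  obtain ⟨-, -, -, α, hα⟩ := hlox
  have hδ : bracket (Q 0) (Q 2) * bracket (P 2) (P 1) * (bracket (Q 2) (Q 1) *
      bracket (P 0) (P 2)) * bracket (P 0) (P 1) * bracket (Q 0) (Q 1) ≠ 0 := by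
    simp only [mul_ne_zero_iff]
    exact ⟨⟨⟨⟨hQ02, hbr n12.symm⟩, hQ21, hbr n02⟩, hbr n01⟩, hQ01⟩
  have hsm := fun i => normalization_eq_smul (hside i) (hQden i)
  have hu := fun i => div_ne_zero (hQden i) (hside i)
  -- Normalizing and rescaling preserve cross-ratios, so the slice representative of `Q` is again a
  -- solution and must be `P`.
  have ht : sliceCoord P Q = 0 := by
    refine hQiso ?_ ?_ ?_ ⟨α, fun i => ?_⟩
    · rw [sliceCoord, bracket_normalization_zero, zero_div]
    · rw [sliceCoord, bracket_normalization_one, zero_div]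
    · rw [sliceCoord, bracket_normalization_two, zero_div]
    · rw [← vecCrossRatio_smul (hu i) (hu (i + 1)) (hu (i + k)) (hu (i + k + 1)), ← hsm, ← hsm,
        ← hsm, ← hsm, vecCrossRatio_map hδ (bracket_normalization P Q), ← (hα i).2.2]
      exact (crossRatio_mk _ _ _ _ (hQ _) (hQ _) (hQ _) (hQ _)).symm
  refine projEquiv_of_injective hP hQ (normalization P Q)
    (normalization_injective (hbr n01) (hbr n02) (hbr n12.symm) hQ01 hQ02 hQ21) fun i => ?_
  have h := hsm i
  rw [ht, Pi.zero_apply, zero_smul, add_zero] at h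
  exact ⟨_, h⟩

end LocalRigidity

end IdealPolygon

theorem mainTheorem12 {K : Type*} [RCLike K] (n k : ℕ) (hn : Odd n) (hk : 2 ≤ k)
    (hkn : k + 2 ≤ n) (P : ZMod n → Fin 2 → K) (hP : ∀ i, P i ≠ 0)
    (hreg : IdealPolygon.IsProjRegular (IdealPolygon.ofVectors P hP)) :
    (∀ V : ZMod n → Fin 2 → K,
      IdealPolygon.IsInfinitesimalLoxogonDeformation k P V ↔
        IdealPolygon.IsTrivialInfinitesimalDeformation P V) ∧
    (∀ᶠ Q in 𝓝 P, ∀ hQ : ∀ i, Q i ≠ 0,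
      IdealPolygon.IsLoxogon k (IdealPolygon.ofVectors Q hQ) →
        IdealPolygon.ProjEquiv (IdealPolygon.ofVectors P hP) (IdealPolygon.ofVectors Q hQ)) := by
  have : NeZero n := ⟨by omega⟩
  have hk0 : (k : ZMod n) ≠ 0 := by
    rw [ne_eq, ZMod.natCast_eq_zero_iff]
    exact Nat.not_dvd_of_pos_of_lt (by omega) (by omega)
  have hk1 : (k : ZMod n) ≠ 1 := by
    rw [← Nat.cast_one, ne_eq, ZMod.natCast_eq_natCast_iff', Nat.mod_eq_of_lt (by omega),
      Nat.mod_eq_of_lt (by omega)]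
    omega
  have hk2 : (k : ZMod n) ≠ -1 := by
    rw [ne_eq, ← add_eq_zero_iff_eq_neg, ← Nat.cast_one, ← Nat.cast_add, ZMod.natCast_eq_zero_iff]
    exact Nat.not_dvd_of_pos_of_lt (by omega) (by omega)
  exact ⟨IdealPolygon.regular_infinitesimal_rigidity hn hreg hk0 hk1 hk2,
    IdealPolygon.regular_local_rigidity hn hreg hk0 hk1 hk2⟩
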